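/- A homeomorphism $f:[0,1]\to[0,1]$ is called piecewise linear if there is a finite set $S\subset[0,1]$ such that $f$ is affine ($x\mapsto ax+b$ with $a,b\in\mathbf R$) on every interval disjoint from $S$. A homeomorphism $f:\mathbf R\to\mathbf R$ is called piecewise projective if there is a finite set $S\subset\mathbf R$ such that on every interval disjoint from $S$ the map $f$ agrees with a projective transformation $x\mapsto\frac{ax+b}{cx+d}$ of $\mathbf R\cup\{\infty\}$, with $a,b,c,d\in\mathbf R$ and $ad-bc\neq0$. (Orientation-reversing homeomorphisms are allowed.) For a discrete group $G$, let $C^n_b(G)$ be the space of bounded functions $G^n\to\mathbf R$, with differential $$\delta^n f(g_1,\dots,g_{n+1})=f(g_2,\dots,g_{n+1})+\sum_{i=1}^{n}(-1)^i f(g_1,\dots,g_ig_{i+1},\dots,g_{n+1})+(-1)^{n+1}f(g_1,\dots,g_n),$$ and let $H^2_b(G;\mathbf R)=\ker(\delta^2|_{C^2_b(G)})/\delta^1(C^1_b(G))$ be the second bounded cohomology of $G$ with trivial real coefficients. Let $G$ be any group (under composition) consisting of piecewise linear homeomorphisms of the interval $[0,1]$, or any group consisting of piecewise projective homeomorphisms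 of the real line $\mathbf R$. Then $H^2_b(G;\mathbf R)=0$. -/

import Mathlib

open scoped unitInterval

section BoundedCohomology

variable (G : Type) [Group G]

/-- The differential of the (inhomogeneous) bar complex of `G` with trivial real coefficients:
`(δ f)(g₁, …, gₙ₊₁) = f (g₂, …, gₙ₊₁) + ∑_{i=1}^{n} (-1)ⁱ f (g₁, …, gᵢ gᵢ₊₁, …, gₙ₊₁)
  + (-1)ⁿ⁺¹ f (g₁, …, gₙ)`.
The index `j` below is `i - 1`; for `j = n` the tuple `Fin.contractNth j (· * ·) g` is `g` with
its last entry removed. -/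
def barDifferential (n : ℕ) : ((Fin n → G) → ℝ) →ₗ[ℝ] ((Fin (n + 1) → G) → ℝ) where
  toFun f g := f (fun i => g i.succ) +
    ∑ j : Fin (n + 1), (-1 : ℝ) ^ ((j : ℕ) + 1) * f (Fin.contractNth j (· * ·) g)
  map_add' f f' := by
    funext g
    simp only [Pi.add_apply, mul_add, Finset.sum_add_distrib]
    ring
  map_smul' c f := by
    funext g
    simp only [Pi.smul_apply, smul_eq_mul, RingHom.id_apply, mul_add, Finset.mul_sum]
    congr 1
    exact Finset.sum_congr rfl fun j _ => by ring

/-- `C^n_b(G)`: the bounded real-valued functions on `Gⁿ`. -/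
def boundedCochains (n : ℕ) : Submodule ℝ ((Fin n → G) → ℝ) where
  carrier := {f | ∃ C : ℝ, ∀ g, |f g| ≤ C}
  zero_mem' := ⟨0, fun g => by simp⟩
  add_mem' := by
    rintro f f' ⟨C, hC⟩ ⟨C', hC'⟩
    exact ⟨C + C', fun g => (abs_add_le _ _).trans (add_le_add (hC g) (hC' g))⟩
  smul_mem' := by
    rintro c f ⟨C, hC⟩
    refine ⟨|c| * C, fun g => ?_⟩
    rw [Pi.smul_apply, smul_eq_mul, abs_mul]
    exact mul_le_mul_of_nonneg_left (hC g) (abs_nonneg c)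

theorem barDifferential_mem_boundedCochains (n : ℕ) :
    ∀ f ∈ boundedCochains G n, barDifferential G n f ∈ boundedCochains G (n + 1) := by
  rintro f ⟨C, hC⟩
  refine ⟨C + ∑ _j : Fin (n + 1), C, fun g => (abs_add_le _ _).trans (add_le_add (hC _) ?_)⟩
  refine (Finset.abs_sum_le_sum_abs _ _).trans (Finset.sum_le_sum fun j _ => ?_)
  rw [abs_mul, abs_pow, abs_neg, abs_one, one_pow, one_mul]
  exact hC _

/-- `Z^n_b(G)`: the bounded cocycles. -/
def boundedCocycles (n : ℕ) : Submodule ℝ ((Fin n → G) → ℝ) :=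
  boundedCochains G n ⊓ LinearMap.ker (barDifferential G n)

/-- `B^n_b(G)`: the bounded coboundaries, that is, the coboundaries of bounded cochains. -/
def boundedCoboundaries : (n : ℕ) → Submodule ℝ ((Fin n → G) → ℝ)
  | 0 => ⊥
  | n + 1 => (boundedCochains G n).map (barDifferential G n)

/-- Consecutive differentials compose to zero. -/
theorem barDifferential_comp (n : ℕ) (f : (Fin n → G) → ℝ) :
    barDifferential G (n + 1) (barDifferential G n f) = 0 := by
  have key : ∀ m : ℕ, ∀ f : (Fin m → G) → ℝ, barDifferential G m f =
      (inhomogeneousCochains.d (Rep.trivial ℝ G ℝ) m).hom f := by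
    intro m f
    funext g
    rfl
  have h := groupCohomology.inhomogeneousCochains.d_comp_d n (A := Rep.trivial ℝ G ℝ)
  have h' := congrArg (fun φ => φ.hom f) h
  rw [key, key]
  exact h'

theorem boundedCoboundaries_le_boundedCocycles (n : ℕ) :
    boundedCoboundaries G n ≤ boundedCocycles G n := by
  cases n with
  | zero => exact bot_le
  | succ n =>
    rintro _ ⟨f, hf, rfl⟩
    exact ⟨barDifferential_mem_boundedCochains G n f hf, barDifferential_comp G n f⟩

/-- `H^n_b(G; ℝ) = Z^n_b(G) / B^n_b(G)`: the bounded cohomology of the discrete group `G` with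
trivial real coefficients. -/
abbrev BoundedCohomology (n : ℕ) : Type :=
  boundedCocycles G n ⧸ (boundedCoboundaries G n).submoduleOf (boundedCocycles G n)

end BoundedCohomology

/-- A homeomorphism `f` of the unit interval is piecewise linear if there is a finite set `S` of
breakpoints such that `f` is affine on every interval that does not meet `S`. -/
def IsPiecewiseLinear (f : I ≃ₜ I) : Prop :=
  ∃ S : Finset I, ∀ J : Set I, J.OrdConnected → Disjoint J (S : Set I) →
    ∃ a b : ℝ, ∀ x ∈ J, (f x : ℝ) = a * x + b

/-- A homeomorphism `f` of the real line is piecewise projective if there is a finite set `S` of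
breakpoints such that on every interval that does not meet `S` the map `f` agrees with a
projective transformation of the real projective line `ℝ ∪ {∞}`, that is, with the
fractional linear action of an invertible real `2 × 2` matrix. -/
def IsPiecewiseProjective (f : ℝ ≃ₜ ℝ) : Prop :=
  ∃ S : Finset ℝ, ∀ J : Set ℝ, J.OrdConnected → Disjoint J (S : Set ℝ) →
    ∃ A : GL (Fin 2) ℝ, ∀ x ∈ J, ((f x : ℝ) : OnePoint ℝ) = A • (x : OnePoint ℝ)

/-! A bounded 2-cocycle `c` defines a central extension `E` of `G` by `ℝ`, whose fiber coordinate is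
a quasimorphism. Its homogenization `q` is the identity on the central `ℝ`. If `q` is additive, then
`g ↦ q (0, g)` is a bounded function whose coboundary is `c`. It is therefore enough that
homogeneous quasimorphisms on `E` are additive (`exists_bounded_primitive`).

Additivity climbs from a derived subgroup to the whole group (`additiveOn_of_commutator`), so only
the preimage of the orientation-preserving elements matters. It acts on a compact interval with
abelian kernel. Additivity concerns two elements at a time, so one may pass to a two-generator
subgroup `Δ`, whose global fixed point set has finite frontier. One-sided germs of `Δ` at global
fixed points are affine in a suitable coordinate, so the second derived subgroup `N` has trivial
germs there (`eventually_apply_eq_of_mem_derivedSeries`).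

Between consecutive global fixed points, elements of `N` are supported away from the ends, and some
element of `Δ` displaces these supports. Commuting conjugates then force additivity
(`additiveOn_of_commuting_conjugates`). Induction over the gaps starts from the kernel of the action
and reaches `N`. -/

/-! ### Homogeneous quasimorphisms and criteria for additivity. -/

section Quasimorphism

open scoped commutatorElement

variable {Γ : Type*} [Group Γ]

/-- A real function on a group is a homogeneous quasimorphism if it is additive up to a bounded
error and homogeneous on powers. -/
structure IsHomogeneousQuasimorphism (q : Γ → ℝ) : Prop where
  bounded : ∃ D : ℝ, ∀ a b, |q (a * b) - q a - q b| ≤ D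
  pow : ∀ a (n : ℕ), q (a ^ n) = n * q a

/-- `q` is additive on the subgroup `H`. -/
def AdditiveOn (q : Γ → ℝ) (H : Subgroup Γ) : Prop :=
  ∀ a ∈ H, ∀ b ∈ H, q (a * b) = q a + q b

theorem AdditiveOn.mono {q : Γ → ℝ} {H K : Subgroup Γ} (h : AdditiveOn q K) (hHK : H ≤ K) :
    AdditiveOn q H :=
  fun a ha b hb => h a (hHK ha) b (hHK hb)

theorem eq_zero_of_nat_mul_abs_le {x C : ℝ} (h : ∀ n : ℕ, n * |x| ≤ C) : x = 0 := by
  by_contra hx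
  have hx' : 0 < |x| := abs_pos.mpr hx
  obtain ⟨n, hn⟩ := exists_nat_gt (C / |x|)
  have := h n
  rw [div_lt_iff₀ hx'] at hn
  linarith

namespace IsHomogeneousQuasimorphism

variable {q : Γ → ℝ} (hq : IsHomogeneousQuasimorphism q)
include hq

theorem comp {Δ : Type*} [Group Δ] (φ : Δ →* Γ) : IsHomogeneousQuasimorphism (q ∘ φ) := by
  obtain ⟨D, hD⟩ := hq.bounded
  exact ⟨⟨D, fun a b => by simpa using hD (φ a) (φ b)⟩, fun a n => by simpa using hq.pow (φ a) n⟩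

theorem map_one : q 1 = 0 := by
  simpa using hq.pow 1 0

/-- Two elements whose powers stay at bounded distance under `q` have the same value. -/
theorem eq_of_pow {a b : Γ} {C : ℝ} (h : ∀ n : ℕ, |q (a ^ n) - q (b ^ n)| ≤ C) : q a = q b := by
  refine sub_eq_zero.mp (eq_zero_of_nat_mul_abs_le (C := C) fun n => ?_)
  have := h n
  rw [hq.pow, hq.pow, ← mul_sub, abs_mul, Nat.abs_cast] at this
  exact this

theorem map_mul_of_commute {a b : Γ} (h : Commute a b) : q (a * b) = q a + q b := by
  obtain ⟨D, hD⟩ := hq.bounded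
  have : q (a * b) - q a - q b = 0 := eq_zero_of_nat_mul_abs_le (C := D) fun n => by
    have := hD (a ^ n) (b ^ n)
    rw [← h.mul_pow, hq.pow, hq.pow, hq.pow, ← mul_sub, ← mul_sub, abs_mul, Nat.abs_cast] at this
    exact this
  linarith

theorem map_inv (a : Γ) : q a⁻¹ = -q a := by
  have := hq.map_mul_of_commute (Commute.refl a).inv_right
  rw [mul_inv_cancel, hq.map_one] at this
  linarith

theorem map_conj (g a : Γ) : q (g * a * g⁻¹) = q a := by
  obtain ⟨D, hD⟩ := hq.bounded
  refine hq.eq_of_pow (C := D + D) fun n => ?_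
  rw [conj_pow]
  have h1 := abs_le.mp (hD (g * a ^ n) g⁻¹)
  have h2 := abs_le.mp (hD g (a ^ n))
  rw [hq.map_inv] at h1
  rw [abs_le]
  constructor <;> linarith [h1.1, h1.2, h2.1, h2.2]

/-- The powers `(x * m) ^ n` and `x ^ n` agree modulo `M`, where `q` vanishes, so their values
differ by at most one defect, independently of `n`. -/
theorem map_mul_of_normal {M : Subgroup Γ} [M.Normal] (hM : ∀ m ∈ M, q m = 0) (x : Γ) {m : Γ}
    (hm : m ∈ M) : q (x * m) = q x := by
  obtain ⟨D, hD⟩ := hq.bounded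
  refine hq.eq_of_pow (C := D) fun n => ?_
  have key : (x ^ n)⁻¹ * (x * m) ^ n ∈ M := by
    rw [← QuotientGroup.eq, QuotientGroup.mk_pow, QuotientGroup.mk_pow, QuotientGroup.mk_mul,
      (QuotientGroup.eq_one_iff m).mpr hm, mul_one]
  have := hD (x ^ n) ((x ^ n)⁻¹ * (x * m) ^ n)
  rw [mul_inv_cancel_left, hM _ key, sub_zero] at this
  exact this

/-- If `a` normalises a subgroup `M` on which `q` is additive, and `a` and `b` commute modulo `M`,
then `q` vanishes on their commutator. -/
theorem map_commutator_eq_zero {M : Subgroup Γ} (h : AdditiveOn q M) {a b : Γ}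
    (ha : ∀ m ∈ M, a * m * a⁻¹ ∈ M) (hab : ⁅a, b⁆ ∈ M) : q ⁅a, b⁆ = 0 := by
  obtain ⟨D, hD⟩ := hq.bounded
  -- Additivity on `M` makes `q ⁅a ^ n, b⁆` grow linearly in `n`. Yet `⁅a ^ n, b⁆` is a conjugate of
  -- `b` times `b⁻¹`, so its value is bounded by the defect.
  have hpow : ∀ n : ℕ, ⁅a ^ n, b⁆ ∈ M ∧ q ⁅a ^ n, b⁆ = n * q ⁅a, b⁆ := by
    intro n
    induction n with
    | zero => simp [hq.map_one, one_mem]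
    | succ n ih =>
      have e : ⁅a ^ (n + 1), b⁆ = (a * ⁅a ^ n, b⁆ * a⁻¹) * ⁅a, b⁆ := by
        simp only [commutatorElement_def, pow_succ']
        group
      have hc : a * ⁅a ^ n, b⁆ * a⁻¹ ∈ M := ha _ ih.1
      refine ⟨e ▸ mul_mem hc hab, ?_⟩
      rw [e, h _ hc _ hab, hq.map_conj, ih.2]
      push_cast
      ring
  refine eq_zero_of_nat_mul_abs_le (C := D) fun n => ?_
  have h1 := hD (a ^ n * b * (a ^ n)⁻¹) b⁻¹
  rw [← commutatorElement_def, hq.map_conj, hq.map_inv, (hpow n).2] at h1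
  simpa [abs_mul] using h1

/-- A homogeneous quasimorphism that is additive on the derived subgroup is additive. -/
theorem additiveOn_of_commutator {H : Subgroup Γ} (h : AdditiveOn q ⁅H, H⁆) : AdditiveOn q H := by
  have hz : ∀ x ∈ ⁅H, H⁆, q x = 0 := by
    intro x hx
    rw [Subgroup.commutator_def] at hx
    induction hx using Subgroup.closure_induction with
    | mem x hx =>
      obtain ⟨a, ha, b, hb, rfl⟩ := hx
      refine hq.map_commutator_eq_zero h (fun m hm => ?_)
        (Subgroup.commutator_mem_commutator ha hb)
      have e : a * m * a⁻¹ = ⁅a, m⁆ * m := by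
        simp only [commutatorElement_def]
        group
      rw [e]
      exact mul_mem (Subgroup.commutator_mem_commutator ha (H.commutator_le_self hm)) hm
    | one => exact hq.map_one
    | mul x y hx hy ihx ihy =>
      rw [h x hx y hy, ihx, ihy, add_zero]
    | inv x hx ih => rw [hq.map_inv, ih, neg_zero]
  obtain ⟨D, hD⟩ := hq.bounded
  intro a ha b hb
  -- Modulo `⁅H, H⁆`, on which `q` vanishes, `(a * b) ^ n` equals `a ^ n * b ^ n`; hence `n` times
  -- the error costs only two defects.
  have : q (a * b) - q a - q b = 0 := eq_zero_of_nat_mul_abs_le (C := D + D) fun n => by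
    have key : (a ^ n * b ^ n)⁻¹ * (a * b) ^ n ∈ ⁅H, H⁆ := by
      have hmem : ∀ (x y : H), ((x ^ n * y ^ n)⁻¹ * (x * y) ^ n : H) ∈ commutator H := by
        intro x y
        rw [← QuotientGroup.eq]
        change (Abelianization.of (x ^ n * y ^ n)) = Abelianization.of ((x * y) ^ n)
        rw [map_mul, map_pow, map_pow, map_pow, map_mul, mul_pow]
      have h1 := Subgroup.mem_map_of_mem H.subtype (hmem ⟨a, ha⟩ ⟨b, hb⟩)
      rw [commutator_def, Subgroup.map_commutator, ← MonoidHom.range_eq_map,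
        Subgroup.range_subtype] at h1
      exact h1
    have h1 := hD (a ^ n * b ^ n) ((a ^ n * b ^ n)⁻¹ * (a * b) ^ n)
    have h2 := hD (a ^ n) (b ^ n)
    rw [mul_inv_cancel_left, hz _ key, hq.pow, sub_zero] at h1
    rw [hq.pow, hq.pow] at h2
    calc n * |q (a * b) - q a - q b| = |n * (q (a * b) - q a - q b)| := by
          rw [abs_mul, Nat.abs_cast]
      _ = |(n * q (a * b) - q (a ^ n * b ^ n)) + (q (a ^ n * b ^ n) - n * q a - n * q b)| := by
          ring_nf
      _ ≤ D + D := (abs_add_le _ _).trans (add_le_add h1 h2)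
  linarith

theorem additiveOn_of_derivedSeries (n : ℕ) (h : AdditiveOn q (derivedSeries Γ n)) :
    AdditiveOn q ⊤ := by
  induction n with
  | zero => exact h
  | succ n ih => exact ih (hq.additiveOn_of_commutator h)

/-- The kernel of `q` on a normal subgroup where it is additive. -/
theorem exists_normal_ker {M : Subgroup Γ} [M.Normal] (h : AdditiveOn q M) :
    ∃ K : Subgroup Γ, K.Normal ∧ ∀ x, x ∈ K ↔ x ∈ M ∧ q x = 0 :=
  ⟨{ carrier := {x | x ∈ M ∧ q x = 0}
     one_mem' := ⟨one_mem _, hq.map_one⟩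
     mul_mem' := fun {x y} hx hy =>
       ⟨mul_mem hx.1 hy.1, by rw [h x hx.1 y hy.1, hx.2, hy.2, add_zero]⟩
     inv_mem' := fun {x} hx => ⟨inv_mem hx.1, by rw [hq.map_inv, hx.2, neg_zero]⟩ },
   ⟨fun x hx g => ⟨Subgroup.Normal.conj_mem ‹_› x hx.1 g, (hq.map_conj g x).trans hx.2⟩⟩,
   fun _ => Iff.rfl⟩

/-- The commutator lies in the kernel `K` of `q` on `M`, so `a` and `b` commute modulo `K`, a normal
subgroup to which `q` is insensitive. The argument for commuting elements then applies. -/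
theorem map_mul_of_commutator_mem {M : Subgroup Γ} [M.Normal] (h : AdditiveOn q M) {a b : Γ}
    (hab : ⁅a, b⁆ ∈ M) : q (a * b) = q a + q b := by
  obtain ⟨K, hK, hKmem⟩ := hq.exists_normal_ker h
  have hz : ∀ m ∈ K, q m = 0 := fun m hm => ((hKmem m).1 hm).2
  have hcomm : ⁅a, b⁆ ∈ K := (hKmem _).2 ⟨hab, hq.map_commutator_eq_zero h
    (fun m hm => Subgroup.Normal.conj_mem ‹_› m hm _) hab⟩
  obtain ⟨D, hD⟩ := hq.bounded
  have hc : Commute (a : Γ ⧸ K) (b : Γ ⧸ K) := by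
    rw [← commutatorElement_eq_one_iff_commute]
    exact (QuotientGroup.eq_one_iff _).mpr hcomm
  have : q (a * b) - q a - q b = 0 := eq_zero_of_nat_mul_abs_le (C := D) fun n => by
    have key : (a ^ n * b ^ n)⁻¹ * (a * b) ^ n ∈ K := by
      rw [← QuotientGroup.eq]
      simp only [QuotientGroup.mk_mul, QuotientGroup.mk_pow]
      exact (hc.mul_pow n).symm
    have h1 := hq.map_mul_of_normal hz (a ^ n * b ^ n) key
    rw [mul_inv_cancel_left, hq.pow] at h1
    have h2 := hD (a ^ n) (b ^ n)
    rw [← h1, hq.pow, hq.pow, ← mul_sub, ← mul_sub, abs_mul, Nat.abs_cast] at h2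
    exact h2
  linarith

/-- Additivity passes from `M` to `N` when any two elements of `N` commute modulo `M` with their
conjugates by a suitable element. -/
theorem additiveOn_of_commuting_conjugates {M N : Subgroup Γ} [M.Normal] [N.Normal]
    (h : AdditiveOn q M)
    (hN : ∀ a ∈ N, ∀ b ∈ N, ∃ f : Γ, ⁅a, f * a * f⁻¹⁆ ∈ M ∧ ⁅b, f * b * f⁻¹⁆ ∈ M ∧
      ⁅a * b, f * (a * b) * f⁻¹⁆ ∈ M ∧ ⁅b, f * a * f⁻¹⁆ ∈ M) :
    AdditiveOn q N := by
  obtain ⟨K, hK, hKmem⟩ := hq.exists_normal_ker h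
  have hz : ∀ m ∈ K, q m = 0 := fun m hm => ((hKmem m).1 hm).2
  -- Halving the defect: with `a'`, `b'` the conjugates by `f`, the bound for the pair `a * a'`, `b
  -- * b'` is twice the error for `a`, `b`, since modulo `K` the product `a * a' * b * b'` equals `a
  -- * b * (a' * b')`.
  have step : ∀ D : ℝ, (∀ a ∈ N, ∀ b ∈ N, |q (a * b) - q a - q b| ≤ D) →
      ∀ a ∈ N, ∀ b ∈ N, |q (a * b) - q a - q b| ≤ D / 2 := by
    intro D hD a ha b hb
    obtain ⟨f, haa, hbb, hab, hba⟩ := hN a ha b hb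
    have haN : f * a * f⁻¹ ∈ N := Subgroup.Normal.conj_mem ‹_› a ha f
    have hbN : f * b * f⁻¹ ∈ N := Subgroup.Normal.conj_mem ‹_› b hb f
    have h1 := hD (a * (f * a * f⁻¹)) (mul_mem ha haN) (b * (f * b * f⁻¹)) (mul_mem hb hbN)
    have hcomm : ⁅b, f * a * f⁻¹⁆ ∈ K :=
      (hKmem _).2 ⟨hba, hq.map_commutator_eq_zero h
        (fun m hm => Subgroup.Normal.conj_mem ‹_› m hm _) hba⟩
    have hc : Commute (b : Γ ⧸ K) ((f * a * f⁻¹ : Γ) : Γ ⧸ K) := by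
      rw [← commutatorElement_eq_one_iff_commute]
      exact (QuotientGroup.eq_one_iff _).mpr hcomm
    have key : (a * b * (f * (a * b) * f⁻¹))⁻¹ *
        (a * (f * a * f⁻¹) * (b * (f * b * f⁻¹))) ∈ K := by
      rw [← QuotientGroup.eq]
      have e : f * (a * b) * f⁻¹ = (f * a * f⁻¹) * (f * b * f⁻¹) := by group
      rw [e]
      generalize f * a * f⁻¹ = a' at hc
      simp only [QuotientGroup.mk_mul] at hc ⊢
      simp only [mul_assoc]
      rw [← mul_assoc (b : Γ ⧸ K), hc.eq, mul_assoc]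
    have h2 := hq.map_mul_of_normal hz (a * b * (f * (a * b) * f⁻¹)) key
    rw [mul_inv_cancel_left] at h2
    rw [h2, hq.map_mul_of_commutator_mem h haa, hq.map_mul_of_commutator_mem h hbb,
      hq.map_mul_of_commutator_mem h hab, hq.map_conj, hq.map_conj, hq.map_conj] at h1
    have e : q (a * b) + q (a * b) - (q a + q a) - (q b + q b) = 2 * (q (a * b) - q a - q b) := by
      ring
    rw [e, abs_mul, abs_two] at h1
    linarith
  obtain ⟨D, hD⟩ := hq.bounded
  have all : ∀ n : ℕ, ∀ a ∈ N, ∀ b ∈ N, |q (a * b) - q a - q b| ≤ D / 2 ^ n := by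
    intro n
    induction n with
    | zero => intro a _ b _; simpa using hD a b
    | succ n ih =>
      intro a ha b hb
      refine (step _ ih a ha b hb).trans_eq ?_
      rw [pow_succ, div_div]
  intro a ha b hb
  have hlim : Filter.Tendsto (fun n : ℕ => D / (2 : ℝ) ^ n) Filter.atTop (nhds 0) :=
    tendsto_const_nhds.div_atTop (tendsto_pow_atTop_atTop_of_one_lt one_lt_two)
  have := abs_nonpos_iff.mp (ge_of_tendsto' hlim fun n => all n a ha b hb)
  linarith

end IsHomogeneousQuasimorphism

/-- Every quasimorphism is at bounded distance from a homogeneous one. -/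
theorem exists_isHomogeneousQuasimorphism {p : Γ → ℝ} {D : ℝ}
    (hD : ∀ a b, |p (a * b) - p a - p b| ≤ D) :
    ∃ q : Γ → ℝ, IsHomogeneousQuasimorphism q ∧ (∀ a, |q a - p a| ≤ D) ∧
      ∀ a, Filter.Tendsto (fun n : ℕ => p (a ^ n) / n) Filter.atTop (nhds (q a)) := by
  have hD0 : 0 ≤ D := (abs_nonneg _).trans (hD 1 1)
  have hpow : ∀ a (n : ℕ), |p (a ^ (n + 1)) - (n + 1) * p a| ≤ n * D := by
    intro a n
    induction n with
    | zero => simp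
    | succ n ih =>
      have h1 := hD (a ^ (n + 1)) a
      rw [← pow_succ] at h1
      push_cast
      rw [abs_le] at *
      constructor <;> linarith [h1.1, h1.2, ih.1, ih.2]
  -- Adding `D` makes the sequence subadditive, so Fekete's lemma provides the limit.
  have hsub : ∀ a, Subadditive fun n : ℕ => p (a ^ n) + D := by
    intro a m n
    have := (abs_le.mp (hD (a ^ m) (a ^ n))).2
    rw [← pow_add] at this
    linarith
  have hbdd : ∀ a, BddBelow (Set.range fun n : ℕ => (p (a ^ n) + D) / n) := by
    intro a
    refine ⟨-|p a| - D, ?_⟩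
    rintro _ ⟨n, rfl⟩
    rcases n with _ | n
    · simp only [Nat.cast_zero, div_zero]
      linarith [abs_nonneg (p a)]
    · have h1 := (abs_le.mp (hpow a n)).1
      have h2 := neg_abs_le (p a)
      simp only
      rw [le_div_iff₀ (by positivity)]
      push_cast
      nlinarith [mul_le_mul_of_nonneg_left h2 (by positivity : (0 : ℝ) ≤ n + 1)]
  have hlim : ∀ a, Filter.Tendsto (fun n : ℕ => p (a ^ n) / n) Filter.atTop
      (nhds (hsub a).lim) := by
    intro a
    have h1 := (hsub a).tendsto_lim (hbdd a)
    have h2 := h1.sub (tendsto_const_div_atTop_nhds_zero_nat D)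
    rw [sub_zero] at h2
    refine h2.congr fun n => ?_
    ring
  have hclose : ∀ a, |(hsub a).lim - p a| ≤ D := by
    intro a
    have h1 := (((hlim a).comp (Filter.tendsto_add_atTop_nat 1)).sub_const (p a)).abs
    refine le_of_tendsto' h1 fun n => ?_
    have h2 : (0 : ℝ) < n + 1 := by positivity
    have h3 : p (a ^ (n + 1)) / ((n + 1 : ℕ) : ℝ) - p a =
        (p (a ^ (n + 1)) - (n + 1) * p a) / (n + 1) := by
      push_cast
      field_simp
    simp only [Function.comp_apply]
    rw [h3, abs_div, abs_of_pos h2, div_le_iff₀ h2]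
    refine (hpow a n).trans ?_
    nlinarith
  -- The defect `4 D` is that of `p` plus three replacements of `q` by `p`.
  refine ⟨fun a => (hsub a).lim, ⟨⟨D + D + D + D, fun a b => ?_⟩, fun a k => ?_⟩, hclose, hlim⟩
  · have h1 := abs_le.mp (hclose a)
    have h2 := abs_le.mp (hclose b)
    have h3 := abs_le.mp (hclose (a * b))
    have h4 := abs_le.mp (hD a b)
    rw [abs_le]
    constructor <;> linarith [h1.1, h1.2, h2.1, h2.2, h3.1, h3.2, h4.1, h4.2]
  · rcases Nat.eq_zero_or_pos k with rfl | hk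
    · have h1 := hlim (a ^ 0)
      simp only [pow_zero, one_pow] at h1
      have := tendsto_nhds_unique h1 (tendsto_const_div_atTop_nhds_zero_nat (p 1))
      simpa using this
    · have h1 := (hlim a).comp (Filter.tendsto_id.const_mul_atTop' hk)
      have h2 := h1.const_mul (k : ℝ)
      refine tendsto_nhds_unique (hlim (a ^ k)) (h2.congr fun n => ?_)
      have : (k : ℝ) ≠ 0 := by positivity
      simp only [Function.comp_apply, id, pow_mul, Nat.cast_mul]
      field_simp

end Quasimorphism

/-! ### Propagating additivity along the global fixed points. -/

section Dynamics

open scoped commutatorElement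

variable {Γ X : Type*} [Group Γ] [CompleteLinearOrder X]

/-- The common fixed points of a group of order automorphisms. -/
def globalFixedPoints (ρ : Γ →* (X ≃o X)) : Set X :=
  {x | ∀ g, ρ g x = x}

/-- The elements of `N` that act trivially on `[t, ⊤]`. -/
def fixingAbove (ρ : Γ →* (X ≃o X)) (N : Subgroup Γ) (t : X) : Subgroup Γ where
  carrier := {n | n ∈ N ∧ ∀ z, t ≤ z → ρ n z = z}
  one_mem' := ⟨one_mem _, fun z _ => by simp⟩
  mul_mem' := fun {m n} hm hn =>
    ⟨mul_mem hm.1 hn.1, fun z hz => by rw [map_mul, RelIso.mul_apply, hn.2 z hz, hm.2 z hz]⟩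
  inv_mem' := fun {n} hn => ⟨inv_mem hn.1, fun z hz => by
    nth_rewrite 1 [← hn.2 z hz]
    rw [← RelIso.mul_apply, ← map_mul, inv_mul_cancel, map_one, RelIso.one_apply]⟩

theorem map_inv_apply_map_apply (ρ : Γ →* (X ≃o X)) (g : Γ) (z : X) : ρ g⁻¹ (ρ g z) = z := by
  rw [← RelIso.mul_apply, ← map_mul, inv_mul_cancel, map_one, RelIso.one_apply]

theorem map_apply_map_inv_apply (ρ : Γ →* (X ≃o X)) (g : Γ) (z : X) : ρ g (ρ g⁻¹ z) = z := by
  rw [← RelIso.mul_apply, ← map_mul, mul_inv_cancel, map_one, RelIso.one_apply]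

theorem fixingAbove_normal {ρ : Γ →* (X ≃o X)} {N : Subgroup Γ} [hN : N.Normal] {t : X}
    (ht : t ∈ globalFixedPoints ρ) : (fixingAbove ρ N t).Normal where
  conj_mem n hn g := by
    refine ⟨hN.conj_mem n hn.1 g, fun z hz => ?_⟩
    have h1 : t ≤ ρ g⁻¹ z := by
      rw [← ht g⁻¹]
      exact (ρ g⁻¹).monotone hz
    rw [map_mul, map_mul, RelIso.mul_apply, RelIso.mul_apply, hn.2 _ h1,
      map_apply_map_inv_apply]

/-- Between consecutive global fixed points every orbit is unbounded. -/
theorem exists_lt_map_apply {ρ : Γ →* (X ≃o X)} {s t x y : X} (ht : t ∈ globalFixedPoints ρ)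
    (hst : ∀ z ∈ Set.Ioo s t, z ∉ globalFixedPoints ρ) (hx : x ∈ Set.Ioo s t) (hy : y < t) :
    ∃ f, y < ρ f x := by
  -- The supremum of an orbit is a global fixed point, so it can only be `t`.
  set c := ⨆ f, ρ f x with hc
  have hcfix : c ∈ globalFixedPoints ρ := by
    intro g
    rw [hc, OrderIso.map_iSup]
    simp_rw [← RelIso.mul_apply, ← map_mul]
    exact (Equiv.mulLeft g).iSup_comp (g := fun f => ρ f x)
  have hxc : x ≤ c := by simpa using le_iSup (fun f => ρ f x) 1
  have hct : c ≤ t := iSup_le fun f => by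
    rw [← ht f]
    exact (ρ f).monotone hx.2.le
  have : c = t := by
    by_contra hne
    exact hst c ⟨hx.1.trans_le hxc, lt_of_le_of_ne hct hne⟩ hcfix
  rw [← this, hc] at hy
  exact lt_iSup_iff.mp hy

/-- Elements with disjoint supports in `[s, ⊤]` have a commutator acting trivially there. -/
theorem commutator_apply_of_disjoint_support {ρ : Γ →* (X ≃o X)} {s y : X}
    (hs : s ∈ globalFixedPoints ρ) (hsy : s ≤ y) {c d : Γ} (hc : ∀ z, y ≤ z → ρ c z = z)
    (hd : ∀ z, s ≤ z → z ≤ y → ρ d z = z) (z : X) (hz : s ≤ z) : ρ ⁅c, d⁆ z = z := by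
  -- In terms of `w` the claim is that `c` and `d` commute at `w`. Both preserve `[s, y]` and `[y,
  -- ⊤]`, and on each of these one of them is the identity.
  set w := ρ (d * c)⁻¹ z with hw
  have hzw : z = ρ (d * c) w := (map_apply_map_inv_apply ρ _ z).symm
  have hsw : s ≤ w := by
    rw [← hs (d * c)⁻¹]
    exact (ρ _).monotone hz
  have e : ρ ⁅c, d⁆ z = ρ c (ρ d w) := by
    rw [hw, ← RelIso.mul_apply, ← RelIso.mul_apply, ← map_mul, ← map_mul, commutatorElement_def]
    group
  rw [e, hzw, map_mul, RelIso.mul_apply]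
  rcases le_total w y with h | h
  · rw [hd w hsw h]
    refine (hd _ ?_ ?_).symm
    · rw [← hs c]
      exact (ρ c).monotone hsw
    · rw [← hc y le_rfl]
      exact (ρ c).monotone h
  · rw [hc w h]
    refine hc _ ?_
    rw [← hd y hsy le_rfl]
    exact (ρ d).monotone h

variable [DenselyOrdered X]

/-- Two elements `a`, `b` move points of `(s, t)` only between some `x` and `y`. An `f` sending `x`
beyond `y` makes conjugates that are trivial on `[s, y]`, while `a` and `b` are trivial on `[y, ⊤]`.
The commutators needed for `additiveOn_of_commuting_conjugates` are thus trivial on `[s, ⊤]`. -/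
theorem IsHomogeneousQuasimorphism.additiveOn_fixingAbove_of_consecutive
    {q : Γ → ℝ} (hq : IsHomogeneousQuasimorphism q) {ρ : Γ →* (X ≃o X)} {N : Subgroup Γ}
    [hN : N.Normal]
    (hright : ∀ x ∈ globalFixedPoints ρ, x ≠ ⊤ → ∀ n ∈ N, ∃ y > x, ∀ z ∈ Set.Ioo x y, ρ n z = z)
    (hleft : ∀ x ∈ globalFixedPoints ρ, x ≠ ⊥ → ∀ n ∈ N, ∃ y < x, ∀ z ∈ Set.Ioo y x, ρ n z = z)
    {s t : X} (hs : s ∈ globalFixedPoints ρ) (ht : t ∈ globalFixedPoints ρ) (hlt : s < t)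
    (hst : ∀ z ∈ Set.Ioo s t, z ∉ globalFixedPoints ρ)
    (h : AdditiveOn q (fixingAbove ρ N s)) : AdditiveOn q (fixingAbove ρ N t) := by
  have := fixingAbove_normal (N := N) hs
  have := fixingAbove_normal (N := N) ht
  refine hq.additiveOn_of_commuting_conjugates h fun a ha b hb => ?_
  obtain ⟨xa, hxa, hxa'⟩ := hright s hs (ne_top_of_lt hlt) a ha.1
  obtain ⟨xb, hxb, hxb'⟩ := hright s hs (ne_top_of_lt hlt) b hb.1
  obtain ⟨ya, hya, hya'⟩ := hleft t ht (ne_bot_of_gt hlt) a ha.1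
  obtain ⟨yb, hyb, hyb'⟩ := hleft t ht (ne_bot_of_gt hlt) b hb.1
  obtain ⟨x, hsx, hx⟩ := exists_between (lt_min (lt_min hxa hxb) hlt)
  obtain ⟨y, hy, hyt⟩ := exists_between (max_lt (max_lt hya hyb) hlt)
  simp only [lt_min_iff, max_lt_iff] at hx hy
  obtain ⟨f, hf⟩ := exists_lt_map_apply ht hst ⟨hsx, hx.2⟩ hyt
  have low : ∀ c : Γ, (∀ z ∈ Set.Ioo s x, ρ c z = z) → ρ c x = x → ∀ z, s ≤ z → z ≤ x →
      ρ c z = z := by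
    intro c hc hcx z hz hzx
    rcases hz.eq_or_lt with rfl | hz
    · exact hs c
    rcases hzx.eq_or_lt with rfl | hzx
    · exact hcx
    · exact hc z ⟨hz, hzx⟩
  have high : ∀ c ∈ fixingAbove ρ N t, (∀ z ∈ Set.Ico y t, ρ c z = z) → ∀ z, y ≤ z → ρ c z = z := by
    intro c hcN hc z hz
    rcases lt_or_ge z t with h | h
    · exact hc z ⟨hz, h⟩
    · exact hcN.2 z h
  have la : ∀ z, s ≤ z → z ≤ x → ρ a z = z :=
    low a (fun z hz => hxa' z ⟨hz.1, hz.2.trans hx.1.1⟩) (hxa' x ⟨hsx, hx.1.1⟩)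
  have lb : ∀ z, s ≤ z → z ≤ x → ρ b z = z :=
    low b (fun z hz => hxb' z ⟨hz.1, hz.2.trans hx.1.2⟩) (hxb' x ⟨hsx, hx.1.2⟩)
  have ua : ∀ z, y ≤ z → ρ a z = z :=
    high a ha fun z hz => hya' z ⟨hy.1.1.trans_le hz.1, hz.2⟩
  have ub : ∀ z, y ≤ z → ρ b z = z :=
    high b hb fun z hz => hyb' z ⟨hy.1.2.trans_le hz.1, hz.2⟩
  have conj : ∀ c, (∀ z, s ≤ z → z ≤ x → ρ c z = z) → ∀ z, s ≤ z → z ≤ y →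
      ρ (f * c * f⁻¹) z = z := by
    intro c hc z hz hzy
    rw [map_mul, map_mul, RelIso.mul_apply, RelIso.mul_apply, hc, map_apply_map_inv_apply]
    · rw [← hs f⁻¹]
      exact (ρ _).monotone hz
    · rw [← map_inv_apply_map_apply ρ f x]
      exact (ρ _).monotone (hzy.trans hf.le)
  have main : ∀ c d : Γ, c ∈ N → d ∈ N → (∀ z, y ≤ z → ρ c z = z) →
      (∀ z, s ≤ z → z ≤ x → ρ d z = z) → ⁅c, f * d * f⁻¹⁆ ∈ fixingAbove ρ N s := by
    intro c d hcN hdN hc hd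
    refine ⟨?_, fun z hz => commutator_apply_of_disjoint_support hs hy.2.le hc (conj d hd) z hz⟩
    rw [commutatorElement_def]
    have hdN' := hN.conj_mem d hdN f
    exact mul_mem (mul_mem (mul_mem hcN hdN') (inv_mem hcN)) (inv_mem hdN')
  refine ⟨f, main a a ha.1 ha.1 ua la, main b b hb.1 hb.1 ub lb,
    main _ _ (mul_mem ha.1 hb.1) (mul_mem ha.1 hb.1) ?_ ?_, main b a hb.1 ha.1 ub la⟩
  · intro z hz
    rw [map_mul, RelIso.mul_apply, ub z hz, ua z hz]
  · intro z hz hzx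
    rw [map_mul, RelIso.mul_apply, lb z hz hzx, la z hz hzx]

variable [TopologicalSpace X] [OrderTopology X]

/-- Let a group act on a complete dense linear order such that its global fixed point set has
finite frontier and the elements of a normal subgroup `N` are trivial near the global fixed
points. Then a homogeneous quasimorphism that is additive on the kernel is additive on `N`. -/
theorem IsHomogeneousQuasimorphism.additiveOn_of_trivial_germs
    {q : Γ → ℝ} (hq : IsHomogeneousQuasimorphism q) {ρ : Γ →* (X ≃o X)} {N : Subgroup Γ}
    [hN : N.Normal] (hfin : (frontier (globalFixedPoints ρ)).Finite)
    (hright : ∀ x ∈ globalFixedPoints ρ, x ≠ ⊤ → ∀ n ∈ N, ∃ y > x, ∀ z ∈ Set.Ioo x y, ρ n z = z)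
    (hleft : ∀ x ∈ globalFixedPoints ρ, x ≠ ⊥ → ∀ n ∈ N, ∃ y < x, ∀ z ∈ Set.Ioo y x, ρ n z = z)
    (hker : AdditiveOn q ρ.ker) : AdditiveOn q N := by
  have hclosed : IsClosed (globalFixedPoints ρ) := by
    rw [globalFixedPoints, Set.ofPred_forall]
    exact isClosed_iInter fun g => isClosed_eq (ρ g).continuous continuous_id
  have hbot : ⊥ ∈ globalFixedPoints ρ := fun g => (ρ g).map_bot
  have htop : ⊤ ∈ globalFixedPoints ρ := fun g => (ρ g).map_top
  set T : Finset X := insert ⊥ (insert ⊤ hfin.toFinset) with hT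
  have hTfix : ∀ t ∈ T, t ∈ globalFixedPoints ρ := by
    intro t ht
    simp only [hT, Finset.mem_insert, Set.Finite.mem_toFinset] at ht
    rcases ht with rfl | rfl | ht
    · exact hbot
    · exact htop
    · exact hclosed.frontier_subset ht
  -- Induction on the number of points of `T` below `t`. At `t = ⊥` only the kernel is left; at `t =
  -- ⊤` all of `N` is reached.
  have all : ∀ (k : ℕ) (t : X), t ∈ T → (T.filter (· < t)).card = k →
      AdditiveOn q (fixingAbove ρ N t) := by
    intro k
    induction k using Nat.strong_induction_on with
    | _ k ih =>
      intro t ht hk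
      rcases eq_or_ne t ⊥ with rfl | htbot
      · refine hker.mono fun n hn => ?_
        rw [MonoidHom.mem_ker]
        ext z
        exact hn.2 z bot_le
      have hne : (T.filter (· < t)).Nonempty :=
        ⟨⊥, Finset.mem_filter.mpr ⟨by simp [hT], bot_lt_iff_ne_bot.mpr htbot⟩⟩
      set s := (T.filter (· < t)).max' hne with hsdef
      obtain ⟨hsT, hst⟩ := Finset.mem_filter.mp ((T.filter (· < t)).max'_mem hne)
      rw [← hsdef] at hsT hst
      have hgap : ∀ z ∈ Set.Ioo s t, z ∉ T := fun z hz hzT =>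
        hz.1.not_ge (Finset.le_max' _ _ (Finset.mem_filter.mpr ⟨hzT, hz.2⟩))
      have hIH : AdditiveOn q (fixingAbove ρ N s) := by
        refine ih _ ?_ s hsT rfl
        rw [← hk]
        refine Finset.card_lt_card ⟨fun z hz => ?_, fun hsub => ?_⟩
        · rw [Finset.mem_filter] at hz ⊢
          exact ⟨hz.1, hz.2.trans hst⟩
        · have := hsub (Finset.mem_filter.mpr ⟨hsT, hst⟩)
          exact lt_irrefl _ (Finset.mem_filter.mp this).2
      -- The gap contains no frontier point, so by connectedness it is either free of global fixed
      -- points or made of them. In the latter case passing from `s` to `t` adds nothing.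
      by_cases hex : ∃ z ∈ Set.Ioo s t, z ∈ globalFixedPoints ρ
      · obtain ⟨z, hz, hzfix⟩ := hex
        refine hIH.mono fun n hn => ⟨hn.1, fun w hw => ?_⟩
        by_cases hwt : t ≤ w
        · exact hn.2 w hwt
        rcases hw.eq_or_lt with rfl | hw
        · exact hTfix _ hsT n
        by_contra hcon
        have hwc : w ∈ (globalFixedPoints ρ)ᶜ := fun h => hcon (h n)
        have hcover : ∀ u ∈ Set.Ioo s t, u ∈ globalFixedPoints ρ →
            u ∈ interior (globalFixedPoints ρ) := fun u hu huf => by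
          by_contra hint
          exact hgap u hu (by simp [hT, hclosed.frontier_eq, huf, hint])
        obtain ⟨u, -, hu1, hu2⟩ := isPreconnected_Ioo (a := s) (b := t) _ _ isOpen_interior
          hclosed.isOpen_compl (fun u hu => (em _).imp (hcover u hu) id)
          ⟨z, hz, hcover z hz hzfix⟩ ⟨w, ⟨hw, not_le.mp hwt⟩, hwc⟩
        exact hu2 (interior_subset hu1)
      · push Not at hex
        exact hq.additiveOn_fixingAbove_of_consecutive hright hleft (hTfix s hsT) (hTfix t ht)
          hst hex hIH
  refine (all _ ⊤ (by simp [hT]) rfl).mono fun n hn => ⟨hn, fun z hz => ?_⟩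
  rw [top_le_iff.mp hz, (ρ n).map_top]

end Dynamics

/-! ### Affine germs, and additivity for actions that have them. -/

section Germs

open scoped commutatorElement Topology
open Filter

/-- If every element of a group acts, near a common fixed end `l`, by affine maps in a coordinate
`u`, then the second derived subgroup has trivial germs at `l`. -/
theorem eventually_apply_eq_of_mem_derivedSeries {Δ X : Type*} [Group Δ] [LinearOrder X]
    {ρ : Δ →* (X ≃o X)} {l : Filter X} (hl : ∀ g, Tendsto (ρ g) l l)
    (hl' : ∀ s ∈ l, s.Nontrivial) {u : X → ℝ} (hu : ∃ s ∈ l, Set.InjOn u s)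
    (haff : ∀ g, ∃ α β : ℝ, ∀ᶠ z in l, u (ρ g z) = α * u z + β) {n : Δ}
    (hn : n ∈ derivedSeries Δ 2) : ∀ᶠ z in l, ρ n z = z := by
  obtain ⟨s, hs, hsu⟩ := hu
  -- A zero slope would make `u ∘ ρ g` constant near `l`, against injectivity.
  have hne : ∀ g, ∃ α β : ℝ, α ≠ 0 ∧ ∀ᶠ z in l, u (ρ g z) = α * u z + β := by
    intro g
    obtain ⟨α, β, h⟩ := haff g
    refine ⟨α, β, ?_, h⟩
    rintro rfl
    obtain ⟨x, hx, y, hy, hxy⟩ := hl' _ (inter_mem h (hl g hs))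
    refine hxy ((ρ g).injective (hsu hx.2 hy.2 ?_))
    rw [hx.1, hy.1, zero_mul, zero_mul]
  have hinv : ∀ g (α β : ℝ), α ≠ 0 → (∀ᶠ z in l, u (ρ g z) = α * u z + β) →
      ∀ᶠ z in l, u (ρ g⁻¹ z) = (u z - β) / α := by
    intro g α β hα h
    filter_upwards [(hl g⁻¹).eventually h] with z hz
    rw [← RelIso.mul_apply, ← map_mul, mul_inv_cancel, map_one, RelIso.one_apply] at hz
    rw [hz]
    field_simp
    ring
  have hcomm : ∀ g h (α β γ δ : ℝ), α ≠ 0 → γ ≠ 0 → (∀ᶠ z in l, u (ρ g z) = α * u z + β) →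
      (∀ᶠ z in l, u (ρ h z) = γ * u z + δ) →
      ∀ᶠ z in l, u (ρ ⁅g, h⁆ z) = u z + (α * δ + β - γ * β - δ) := by
    intro g h α β γ δ hα hγ hg hh
    have h1 := hinv h γ δ hγ hh
    have h2 := (hl h⁻¹).eventually (hinv g α β hα hg)
    have h3 := ((hl g⁻¹).comp (hl h⁻¹)).eventually hh
    have h4 := ((hl h).comp ((hl g⁻¹).comp (hl h⁻¹))).eventually hg
    filter_upwards [h1, h2, h3, h4] with z h1 h2 h3 h4
    simp only [Function.comp_apply] at h3 h4
    rw [commutatorElement_def, map_mul, map_mul, map_mul, RelIso.mul_apply, RelIso.mul_apply,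
      RelIso.mul_apply, h4, h3, h2, h1]
    field_simp
    ring
  -- Germs that are translations by an amount satisfying `P`. All translations together contain the
  -- first derived subgroup; the zero translation accounts for the second.
  let K : (ℝ → Prop) → Δ → Prop := fun P g => ∃ β, P β ∧ ∀ᶠ z in l, u (ρ g z) = u z + β
  have hK : ∀ P : ℝ → Prop, P 0 → (∀ x y, P x → P y → P (x + y)) → (∀ x, P x → P (-x)) →
      ∃ H : Subgroup Δ, ∀ g, g ∈ H ↔ K P g := by
    intro P h0 hadd hneg
    refine ⟨{ carrier := {g | K P g}, one_mem' := ?_, mul_mem' := ?_, inv_mem' := ?_ },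
      fun _ => Iff.rfl⟩
    · rintro g h ⟨β, hβ, hg⟩ ⟨δ, hδ, hh⟩
      refine ⟨β + δ, hadd _ _ hβ hδ, ?_⟩
      filter_upwards [hh, (hl h).eventually hg] with z h1 h2
      rw [map_mul, RelIso.mul_apply, h2, h1]
      ring
    · exact ⟨0, h0, by simp⟩
    · rintro g ⟨β, hβ, hg⟩
      refine ⟨-β, hneg _ hβ, ?_⟩
      filter_upwards [hinv g 1 β one_ne_zero (by simpa using hg)] with z hz
      rw [hz]
      ring
  obtain ⟨H₁, hH₁⟩ := hK (fun _ => True) trivial (fun _ _ _ _ => trivial) fun _ _ => trivial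
  obtain ⟨H₂, hH₂⟩ := hK (fun β => β = 0) rfl (by rintro _ _ rfl rfl; simp)
    (by rintro _ rfl; simp)
  have h1 : derivedSeries Δ 1 ≤ H₁ := by
    rw [derivedSeries_succ, Subgroup.commutator_le]
    intro g _ h _
    obtain ⟨α, β, hα, hg⟩ := hne g
    obtain ⟨γ, δ, hγ, hh⟩ := hne h
    exact (hH₁ _).2 ⟨_, trivial, hcomm g h α β γ δ hα hγ hg hh⟩
  have h2 : derivedSeries Δ 2 ≤ H₂ := by
    rw [derivedSeries_succ, Subgroup.commutator_le]
    intro g hg h hh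
    obtain ⟨β, -, hg⟩ := (hH₁ g).1 (h1 hg)
    obtain ⟨δ, -, hh⟩ := (hH₁ h).1 (h1 hh)
    refine (hH₂ _).2 ⟨_, ?_, hcomm g h 1 β 1 δ one_ne_zero one_ne_zero (by simpa using hg)
      (by simpa using hh)⟩
    ring
  obtain ⟨_, rfl, hn'⟩ := (hH₂ n).1 (h2 hn)
  filter_upwards [hn', hs, hl n hs] with z h1 h2 h3
  exact hsu h3 h2 (by rw [h1, add_zero])

/-- A closed set in a linear order has finite frontier if, away from finitely many points, it meets
each open interval in a finite set or contains it. -/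
theorem finite_frontier_of_forall_ordConnected {X : Type*} [LinearOrder X] [TopologicalSpace X]
    [OrderTopology X] {F : Set X} (hF : IsClosed F) (S : Finset X)
    (h : ∀ J : Set X, IsOpen J → J.OrdConnected → Disjoint J (S : Set X) →
      (F ∩ J).Finite ∨ J ⊆ F) : (frontier F).Finite := by
  classical
  -- `U` prescribes which points of `S` lie to the left; the sets `J U`, some of them empty, cover
  -- the complement of `S`.
  let J : Finset X → Set X := fun U => ⋂ s ∈ S, if s ∈ U then Set.Ioi s else Set.Iio s
  have hJ : ∀ U x, x ∈ J U ↔ ∀ s ∈ S, if s ∈ U then s < x else x < s := by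
    intro U x
    simp only [J, Set.mem_iInter]
    refine forall₂_congr fun s _ => ?_
    split_ifs <;> rfl
  have hfin : ∀ U, (frontier F ∩ J U).Finite := by
    intro U
    have hopen : IsOpen (J U) := isOpen_biInter_finset fun s _ => by
      split_ifs
      · exact isOpen_Ioi
      · exact isOpen_Iio
    have hord : (J U).OrdConnected := Set.ordConnected_biInter fun s _ => by
      split_ifs
      · exact Set.ordConnected_Ioi
      · exact Set.ordConnected_Iio
    have hdisj : Disjoint (J U) (S : Set X) := Set.disjoint_left.mpr fun x hx hxS => by
      have := (hJ U x).1 hx x hxS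
      split_ifs at this <;> exact lt_irrefl _ this
    rcases h (J U) hopen hord hdisj with hfin | hsub
    · exact hfin.subset (Set.inter_subset_inter_left _ hF.frontier_subset)
    · convert Set.finite_empty
      refine Set.eq_empty_of_forall_notMem fun x hx => ?_
      exact hx.1.2 (interior_maximal hsub hopen hx.2)
  refine (S.finite_toSet.union (S.powerset.finite_toSet.biUnion fun U _ => hfin U)).subset ?_
  intro x hx
  by_cases hxS : x ∈ S
  · exact Or.inl hxS
  · refine Or.inr (Set.mem_biUnion (x := S.filter (· < x))
      (Finset.mem_coe.mpr (Finset.mem_powerset.mpr (Finset.filter_subset _ _))) ⟨hx, ?_⟩)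
    rw [hJ]
    intro s hs
    have hne : s ≠ x := fun e => hxS (e ▸ hs)
    split_ifs with hmem
    · exact (Finset.mem_filter.mp hmem).2
    · exact lt_of_le_of_ne (not_lt.mp fun hlt => hmem (Finset.mem_filter.mpr ⟨hs, hlt⟩)) hne.symm

/-- The map `f` is affine near `l` in the coordinate `u`. -/
def IsAffineGerm {X : Type*} (l : Filter X) (u : X → ℝ) (f : X → X) : Prop :=
  ∃ α β : ℝ, ∀ᶠ z in l, u (f z) = α * u z + β

/-- The two conditions on order automorphisms used below: fixed point sets have finite frontier,
and one-sided germs at fixed points are affine in a suitable coordinate. -/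
structure HasAffineGerms {X : Type*} [CompleteLinearOrder X] [TopologicalSpace X]
    (A : Set (X ≃o X)) : Prop where
  finite_frontier : ∀ f ∈ A, (frontier {x | f x = x}).Finite
  -- The coordinate depends on the point alone and not on `f`, so that the germs at `x` compose as
  -- affine maps.
  right : ∀ x : X, x ≠ ⊤ → ∃ u : X → ℝ, (∃ s ∈ 𝓝[>] x, Set.InjOn u s) ∧
    ∀ f ∈ A, f x = x → IsAffineGerm (𝓝[>] x) u f
  left : ∀ x : X, x ≠ ⊥ → ∃ u : X → ℝ, (∃ s ∈ 𝓝[<] x, Set.InjOn u s) ∧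
    ∀ f ∈ A, f x = x → IsAffineGerm (𝓝[<] x) u f

theorem HasAffineGerms.mono {X : Type*} [CompleteLinearOrder X] [TopologicalSpace X]
    {A B : Set (X ≃o X)} (hB : HasAffineGerms B) (h : A ⊆ B) : HasAffineGerms A where
  finite_frontier f hf := hB.finite_frontier f (h hf)
  right x hx := (hB.right x hx).imp fun _ hu => ⟨hu.1, fun f hf => hu.2 f (h hf)⟩
  left x hx := (hB.left x hx).imp fun _ hu => ⟨hu.1, fun f hf => hu.2 f (h hf)⟩

theorem OrderIso.tendsto_nhdsGT_of_eq {X : Type*} [LinearOrder X] [TopologicalSpace X]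
    [OrderTopology X] (f : X ≃o X) {x : X} (h : f x = x) : Tendsto f (𝓝[>] x) (𝓝[>] x) := by
  refine tendsto_nhdsWithin_iff.mpr ⟨?_, ?_⟩
  · have := f.continuous.tendsto x
    rw [h] at this
    exact this.mono_left nhdsWithin_le_nhds
  · filter_upwards [self_mem_nhdsWithin] with z hz
    rw [Set.mem_Ioi, ← h]
    exact f.strictMono hz

theorem OrderIso.tendsto_nhdsLT_of_eq {X : Type*} [LinearOrder X] [TopologicalSpace X]
    [OrderTopology X] (f : X ≃o X) {x : X} (h : f x = x) : Tendsto f (𝓝[<] x) (𝓝[<] x) := by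
  refine tendsto_nhdsWithin_iff.mpr ⟨?_, ?_⟩
  · have := f.continuous.tendsto x
    rw [h] at this
    exact this.mono_left nhdsWithin_le_nhds
  · filter_upwards [self_mem_nhdsWithin] with z hz
    rw [Set.mem_Iio, ← h]
    exact f.strictMono hz

variable {X : Type*} [CompleteLinearOrder X] [DenselyOrdered X] [TopologicalSpace X]
  [OrderTopology X]

/-- A homogeneous quasimorphism on a group acting with affine germs is additive as soon as it is
additive on the kernel of the action. -/
theorem IsHomogeneousQuasimorphism.additiveOn_of_hasAffineGerms {E : Type*} [Group E] {q : E → ℝ}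
    (hq : IsHomogeneousQuasimorphism q) {ρ : E →* (X ≃o X)}
    (hρ : HasAffineGerms (Set.range ρ)) (hker : AdditiveOn q ρ.ker) : AdditiveOn q ⊤ := by
  intro a _ b _
  -- With two generators the global fixed point set is an intersection of two sets with finite
  -- frontier; for a larger group finiteness could fail.
  set Δ := Subgroup.closure {a, b}
  have ha : a ∈ Δ := Subgroup.subset_closure (by simp)
  have hb : b ∈ Δ := Subgroup.subset_closure (by simp)
  set τ : Δ →* (X ≃o X) := ρ.comp Δ.subtype with hτ
  have hq' := hq.comp Δ.subtype
  have hτmem : ∀ g : Δ, τ g ∈ Set.range ρ := fun g => ⟨g, rfl⟩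
  have hfix : globalFixedPoints τ = {x | ρ a x = x} ∩ {x | ρ b x = x} := by
    ext x
    refine ⟨fun h => ⟨h ⟨a, ha⟩, h ⟨b, hb⟩⟩, fun h => ?_⟩
    rintro ⟨g, hg⟩
    change ρ g x = x
    induction hg using Subgroup.closure_induction with
    | mem g hg =>
      rcases hg with rfl | rfl
      · exact h.1
      · exact h.2
    | one => simp
    | mul g g' _ _ ih ih' => rw [map_mul, RelIso.mul_apply, ih', ih]
    | inv g _ ih =>
      nth_rewrite 1 [← ih]
      exact map_inv_apply_map_apply ρ g x
  have hfin : (frontier (globalFixedPoints τ)).Finite := by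
    rw [hfix]
    refine ((hρ.finite_frontier _ ⟨a, rfl⟩).union (hρ.finite_frontier _ ⟨b, rfl⟩)).subset ?_
    refine (frontier_inter_subset _ _).trans (Set.union_subset_union ?_ ?_)
    · exact Set.inter_subset_left
    · exact Set.inter_subset_right
  have hder : AdditiveOn (q ∘ Δ.subtype) (derivedSeries Δ 2) := by
    have := derivedSeries_normal Δ 2
    refine hq'.additiveOn_of_trivial_germs hfin ?_ ?_ ?_
    · intro x hx hxt n hn
      obtain ⟨u, hu, haff⟩ := hρ.right x hxt
      obtain ⟨t, ht⟩ : ∃ t, x < t := ⟨⊤, lt_top_iff_ne_top.mpr hxt⟩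
      have key := eventually_apply_eq_of_mem_derivedSeries (ρ := τ) (l := 𝓝[>] x)
        (fun g => (τ g).tendsto_nhdsGT_of_eq (hx g)) (fun s hs => ?_) hu
        (fun g => haff _ (hτmem g) (hx g)) hn
      · obtain ⟨y, hy, hsub⟩ := (mem_nhdsGT_iff_exists_Ioo_subset' ht).mp key
        exact ⟨y, hy, hsub⟩
      · obtain ⟨y, hy, hsub⟩ := (mem_nhdsGT_iff_exists_Ioo_subset' ht).mp hs
        exact (Set.Ioo_infinite hy).nontrivial.mono hsub
    · intro x hx hxt n hn
      obtain ⟨u, hu, haff⟩ := hρ.left x hxt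
      obtain ⟨t, ht⟩ : ∃ t, t < x := ⟨⊥, bot_lt_iff_ne_bot.mpr hxt⟩
      have key := eventually_apply_eq_of_mem_derivedSeries (ρ := τ) (l := 𝓝[<] x)
        (fun g => (τ g).tendsto_nhdsLT_of_eq (hx g)) (fun s hs => ?_) hu
        (fun g => haff _ (hτmem g) (hx g)) hn
      · obtain ⟨y, hy, hsub⟩ := (mem_nhdsLT_iff_exists_Ioo_subset' ht).mp key
        exact ⟨y, hy, hsub⟩
      · obtain ⟨y, hy, hsub⟩ := (mem_nhdsLT_iff_exists_Ioo_subset' ht).mp hs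
        exact (Set.Ioo_infinite hy).nontrivial.mono hsub
    · rintro ⟨m, hm⟩ hm' ⟨n, hn⟩ hn'
      exact hker m hm' n hn'
  exact hq'.additiveOn_of_derivedSeries 2 hder ⟨a, ha⟩ trivial ⟨b, hb⟩ trivial

end Germs

/-! ### From bounded cocycles to quasimorphisms on central extensions. -/

section CentralExtension

/-- The extension of `G` by `ℝ` with cocycle `c`; the group law is
`(s, g) (t, h) = (s + t + c (g, h), g h)`. -/
@[ext]
structure CocycleExtension {G : Type} [Group G] (c : G → G → ℝ)
    (hc : ∀ g h k, c h k - c (g * h) k + c g (h * k) - c g h = 0) where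
  /-- the coordinate in the kernel -/
  fiber : ℝ
  /-- the coordinate in the quotient -/
  base : G

namespace CocycleExtension

variable {G : Type} [Group G] {c : G → G → ℝ}
  {hc : ∀ g h k, c h k - c (g * h) k + c g (h * k) - c g h = 0}

instance : Mul (CocycleExtension c hc) :=
  ⟨fun x y => ⟨x.fiber + y.fiber + c x.base y.base, x.base * y.base⟩⟩

/-- The cocycle is not normalised, hence the fiber `-c 1 1` of the neutral element. -/
instance : One (CocycleExtension c hc) :=
  ⟨⟨-c 1 1, 1⟩⟩

instance : Inv (CocycleExtension c hc) :=
  ⟨fun x => ⟨-c 1 1 - x.fiber - c x.base⁻¹ x.base, x.base⁻¹⟩⟩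

theorem mul_fiber (x y : CocycleExtension c hc) :
    (x * y).fiber = x.fiber + y.fiber + c x.base y.base :=
  rfl

theorem mul_base (x y : CocycleExtension c hc) : (x * y).base = x.base * y.base :=
  rfl

include hc in
theorem cocycle_one_left (g : G) : c 1 g = c 1 1 := by
  have := hc 1 1 g
  simp only [one_mul] at this
  linarith

instance : Group (CocycleExtension c hc) :=
  Group.ofLeftAxioms
    (fun x y z => by
      ext
      · simp only [mul_fiber, mul_base]
        linarith [hc x.base y.base z.base]
      · exact mul_assoc _ _ _)
    (fun x => by
      ext
      · change -c 1 1 + x.fiber + c 1 x.base = x.fiber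
        linarith [cocycle_one_left (hc := hc) x.base]
      · exact one_mul _)
    (fun x => by
      ext
      · change -c 1 1 - x.fiber - c x.base⁻¹ x.base + x.fiber + c x.base⁻¹ x.base = -c 1 1
        ring
      · exact inv_mul_cancel _)

/-- The projection of the extension to the quotient group. -/
def proj (c : G → G → ℝ) (hc : ∀ g h k, c h k - c (g * h) k + c g (h * k) - c g h = 0) :
    CocycleExtension c hc →* G where
  toFun := base
  map_one' := rfl
  map_mul' _ _ := rfl

theorem commute_of_base_eq_one {x y : CocycleExtension c hc} (hx : x.base = 1) (hy : y.base = 1) :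
    Commute x y := by
  ext
  · simp only [mul_fiber, hx, hy]
    ring
  · simp only [mul_base, hx, hy]

/-- The shift by `c 1 1` turns `s ↦ (s - c 1 1, 1)` into a homomorphism onto the central copy of
`ℝ`. -/
theorem pow_mk_one (s : ℝ) (n : ℕ) :
    (⟨s - c 1 1, 1⟩ : CocycleExtension c hc) ^ n = ⟨n * s - c 1 1, 1⟩ := by
  induction n with
  | zero =>
    ext
    · change -c 1 1 = _
      simp
    · rfl
  | succ n ih =>
    rw [pow_succ, ih]
    ext
    · simp only [mul_fiber]
      push_cast
      ring
    · exact one_mul _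

/-- If the homogeneous quasimorphisms on the extension defined by a bounded cocycle `c` that are
additive on the central kernel are additive, then `c` is the coboundary of a bounded function. -/
theorem exists_bounded_primitive {C : ℝ} (hC : ∀ g h, |c g h| ≤ C)
    (H : ∀ q : CocycleExtension c hc → ℝ, IsHomogeneousQuasimorphism q → AdditiveOn q ⊤) :
    ∃ φ : G → ℝ, (∃ D, ∀ g, |φ g| ≤ D) ∧ ∀ g h, c g h = φ g + φ h - φ (g * h) := by
  obtain ⟨q, hq, hclose, hlim⟩ := exists_isHomogeneousQuasimorphism
    (p := fun x : CocycleExtension c hc => x.fiber) (D := C) fun x y => by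
      have e : (x * y).fiber - x.fiber - y.fiber = c x.base y.base := by
        rw [mul_fiber]
        ring
      rw [e]
      exact hC _ _
  have hadd := H q hq
  have hcentral : ∀ s, q ⟨s - c 1 1, 1⟩ = s := by
    intro s
    refine tendsto_nhds_unique (hlim _) ?_
    simp_rw [pow_mk_one]
    have h1 := (tendsto_const_nhds (x := s) (f := Filter.atTop (α := ℕ))).sub
      (tendsto_const_div_atTop_nhds_zero_nat (c 1 1))
    rw [sub_zero] at h1
    refine h1.congr' ?_
    filter_upwards [Filter.eventually_ge_atTop 1] with n hn
    have : (n : ℝ) ≠ 0 := by positivity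
    field_simp
  -- Since `q` is the identity on the central `ℝ`, it is determined by `g ↦ q ⟨0, g⟩`, which is the
  -- bounded primitive.
  have hval : ∀ s g, q ⟨s, g⟩ = s + q ⟨0, g⟩ := by
    intro s g
    have e : (⟨s, g⟩ : CocycleExtension c hc) = ⟨s - c 1 1, 1⟩ * ⟨0, g⟩ := by
      ext
      · simp only [mul_fiber, cocycle_one_left (hc := hc) g]
        ring
      · exact (one_mul _).symm
    rw [e, hadd _ trivial _ trivial, hcentral]
  refine ⟨fun g => q ⟨0, g⟩, ⟨C, fun g => ?_⟩, fun g h => ?_⟩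
  · simpa using hclose ⟨0, g⟩
  · have h1 := hadd ⟨0, g⟩ trivial ⟨0, h⟩ trivial
    have e : (⟨0, g⟩ * ⟨0, h⟩ : CocycleExtension c hc) = ⟨c g h, g * h⟩ := by
      ext
      · simp only [mul_fiber]
        ring
      · rfl
    rw [e, hval] at h1
    linarith

end CocycleExtension

/-- Vanishing of the second bounded cohomology in terms of inhomogeneous cocycles. -/
theorem subsingleton_boundedCohomology_two {G : Type} [Group G]
    (H : ∀ c : G → G → ℝ, (∀ g h k, c h k - c (g * h) k + c g (h * k) - c g h = 0) →
      (∃ C, ∀ g h, |c g h| ≤ C) →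
      ∃ φ : G → ℝ, (∃ D, ∀ g, |φ g| ≤ D) ∧ ∀ g h, c g h = φ g + φ h - φ (g * h)) :
    Subsingleton (BoundedCohomology G 2) := by
  rw [BoundedCohomology, Submodule.Quotient.subsingleton_iff,
    Submodule.submoduleOf_eq_top]
  rintro f ⟨⟨C, hC⟩, hf⟩
  rw [SetLike.mem_coe, LinearMap.mem_ker] at hf
  have hcocycle : ∀ g h k, f ![h, k] - f ![g * h, k] + f ![g, h * k] - f ![g, h] = 0 := by
    intro g h k
    have h1 : f (fun i : Fin 2 => (![g, h, k] : Fin 3 → G) i.succ) + ∑ j : Fin 3,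
        (-1 : ℝ) ^ ((j : ℕ) + 1) * f (Fin.contractNth j (· * ·) ![g, h, k]) = 0 :=
      congrFun hf ![g, h, k]
    have e0 : (fun i : Fin 2 => (![g, h, k] : Fin 3 → G) i.succ) = ![h, k] := by
      ext i
      fin_cases i <;> rfl
    have e1 : Fin.contractNth (0 : Fin 3) (· * ·) ![g, h, k] = ![g * h, k] := by
      ext i
      fin_cases i <;> rfl
    have e2 : Fin.contractNth (1 : Fin 3) (· * ·) ![g, h, k] = ![g, h * k] := by
      ext i
      fin_cases i <;> rfl
    have e3 : Fin.contractNth (2 : Fin 3) (· * ·) ![g, h, k] = ![g, h] := by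
      ext i
      fin_cases i <;> rfl
    rw [Fin.sum_univ_three, e0, e1, e2, e3] at h1
    norm_num at h1
    linarith
  obtain ⟨φ, ⟨D, hD⟩, hφ⟩ := H (fun g h => f ![g, h]) hcocycle ⟨C, fun g h => hC _⟩
  refine ⟨fun x => φ (x 0), ⟨D, fun x => hD _⟩, ?_⟩
  funext x
  have e : x = ![x 0, x 1] := by
    ext i
    fin_cases i <;> rfl
  have h1 := hφ (x 0) (x 1)
  rw [← e] at h1
  rw [h1]
  simp [barDifferential, Fin.sum_univ_two, Fin.contractNth]
  ring

open scoped commutatorElement in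
/-- Let `P` be a subgroup of `G` containing all commutators and acting faithfully with affine
germs. Then the second bounded cohomology of `G` vanishes. -/
theorem subsingleton_boundedCohomology_two_of_hasAffineGerms {G : Type} [Group G] {P : Subgroup G}
    (hP : ∀ g h : G, ⁅g, h⁆ ∈ P) {X : Type*} [CompleteLinearOrder X] [DenselyOrdered X]
    [TopologicalSpace X] [OrderTopology X] {ρ : P →* (X ≃o X)} (hinj : Function.Injective ρ)
    (hρ : HasAffineGerms (Set.range ρ)) : Subsingleton (BoundedCohomology G 2) := by
  refine subsingleton_boundedCohomology_two fun c hc ⟨C, hC⟩ =>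
    CocycleExtension.exists_bounded_primitive (hc := hc) hC fun q hq => ?_
  set π := CocycleExtension.proj c hc
  set τ : P.comap π →* (X ≃o X) := ρ.comp (π.subgroupComap P)
  have hτ : HasAffineGerms (Set.range τ) := by
    refine hρ.mono ?_
    rintro _ ⟨g, rfl⟩
    exact ⟨_, rfl⟩
  have hker : AdditiveOn (q ∘ (P.comap π).subtype) τ.ker := by
    have hbase : ∀ x ∈ τ.ker, (x : CocycleExtension c hc).base = 1 := fun x hx => by
      have h1 : π.subgroupComap P x = 1 := hinj (by rw [map_one]; exact hx)
      exact congrArg Subtype.val h1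
    intro x hx y hy
    exact hq.map_mul_of_commute
      (CocycleExtension.commute_of_base_eq_one (hbase x hx) (hbase y hy))
  have hadd := (hq.comp (P.comap π).subtype).additiveOn_of_hasAffineGerms hτ hker
  -- The derived subgroup of the extension lies over `P`, where additivity is already known.
  refine hq.additiveOn_of_commutator fun x hx y hy => ?_
  have hle : ⁅(⊤ : Subgroup (CocycleExtension c hc)), ⊤⁆ ≤ P.comap π :=
    Subgroup.commutator_le.mpr fun g _ h _ => by
      rw [Subgroup.mem_comap, map_commutatorElement]
      exact hP _ _
  exact hadd ⟨x, hle hx⟩ trivial ⟨y, hle hy⟩ trivial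

end CentralExtension

/-! ### Piecewise linear maps have affine germs. -/

section PiecewiseLinear

open scoped Topology
open Filter

theorem exists_disjoint_Ioo_right {X : Type*} [LinearOrder X] [TopologicalSpace X]
    [OrderTopology X] (S : Finset X) {x t : X} (hxt : x < t) :
    ∃ y > x, Disjoint (Set.Ioo x y) (S : Set X) := by
  have h : ((S : Set X) \ {x})ᶜ ∈ 𝓝[>] x := mem_nhdsWithin_of_mem_nhds
    ((S.finite_toSet.sdiff.isClosed.isOpen_compl).mem_nhds (by simp))
  obtain ⟨y, hy, hsub⟩ := (mem_nhdsGT_iff_exists_Ioo_subset' hxt).mp h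
  exact ⟨y, hy, Set.disjoint_left.mpr fun z hz hzS => hsub hz ⟨hzS, hz.1.ne'⟩⟩

theorem exists_disjoint_Ioo_left {X : Type*} [LinearOrder X] [TopologicalSpace X]
    [OrderTopology X] (S : Finset X) {x t : X} (hxt : t < x) :
    ∃ y < x, Disjoint (Set.Ioo y x) (S : Set X) := by
  have h : ((S : Set X) \ {x})ᶜ ∈ 𝓝[<] x := mem_nhdsWithin_of_mem_nhds
    ((S.finite_toSet.sdiff.isClosed.isOpen_compl).mem_nhds (by simp))
  obtain ⟨y, hy, hsub⟩ := (mem_nhdsLT_iff_exists_Ioo_subset' hxt).mp h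
  exact ⟨y, hy, Set.disjoint_left.mpr fun z hz hzS => hsub hz ⟨hzS, hz.2.ne⟩⟩

/-- The coordinate is the variable itself, and an affine map with two fixed points is the identity.
-/
theorem hasAffineGerms_of_isPiecewiseLinear :
    HasAffineGerms {f : I ≃o I | ∃ h : I ≃ₜ I, IsPiecewiseLinear h ∧ ⇑h = ⇑f} where
  finite_frontier := by
    rintro f ⟨h, ⟨S, hS⟩, hf⟩
    refine finite_frontier_of_forall_ordConnected (isClosed_eq f.continuous continuous_id) S
      fun J _ hJ hJS => ?_
    obtain ⟨a, b, hab⟩ := hS J hJ hJS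
    rw [hf] at hab
    refine or_iff_not_imp_right.mpr fun hnot => Set.Subsingleton.finite ?_
    rintro x ⟨hx, hxJ⟩ y ⟨hy, hyJ⟩
    by_contra hxy
    apply hnot
    have h1 := hab x hxJ
    have h2 := hab y hyJ
    rw [show f x = x from hx] at h1
    rw [show f y = y from hy] at h2
    have hne : (x : ℝ) - y ≠ 0 := sub_ne_zero.mpr fun e => hxy (Subtype.ext e)
    have ha : a = 1 := by
      apply mul_right_cancel₀ hne
      linarith
    have hb : b = 0 := by
      rw [ha] at h1
      linarith
    intro z hz
    refine Subtype.ext ?_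
    rw [hab z hz, ha, hb]
    ring
  right := by
    intro x hx
    refine ⟨fun z => (z : ℝ), ⟨Set.univ, univ_mem, Subtype.val_injective.injOn⟩, ?_⟩
    rintro f ⟨h, ⟨S, hS⟩, hf⟩ -
    obtain ⟨y, hy, hdisj⟩ := exists_disjoint_Ioo_right S (lt_top_iff_ne_top.mpr hx)
    obtain ⟨a, b, hab⟩ := hS _ Set.ordConnected_Ioo hdisj
    rw [hf] at hab
    exact ⟨a, b, mem_of_superset (Ioo_mem_nhdsGT hy) hab⟩
  left := by
    intro x hx
    refine ⟨fun z => (z : ℝ), ⟨Set.univ, univ_mem, Subtype.val_injective.injOn⟩, ?_⟩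
    rintro f ⟨h, ⟨S, hS⟩, hf⟩ -
    obtain ⟨y, hy, hdisj⟩ := exists_disjoint_Ioo_left S (bot_lt_iff_ne_bot.mpr hx)
    obtain ⟨a, b, hab⟩ := hS _ Set.ordConnected_Ioo hdisj
    rw [hf] at hab
    exact ⟨a, b, mem_of_superset (Ioo_mem_nhdsLT hy) hab⟩

end PiecewiseLinear

/-! ### Piecewise projective maps have affine germs on the extended line. -/

section PiecewiseProjective

open scoped Topology
open Filter

/-- `f` agrees with the fractional linear map `x ↦ (a x + b) / (c x + d)` on `J`. -/
def IsProjectiveOn (f : ℝ → ℝ) (J : Set ℝ) (a b c d : ℝ) : Prop :=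
  a * d - b * c ≠ 0 ∧ ∀ x ∈ J, c * x + d ≠ 0 ∧ f x * (c * x + d) = a * x + b

theorem exists_isProjectiveOn {f : ℝ → ℝ} {J : Set ℝ} {A : GL (Fin 2) ℝ}
    (h : ∀ x ∈ J, ((f x : ℝ) : OnePoint ℝ) = A • (x : OnePoint ℝ)) :
    ∃ a b c d, IsProjectiveOn f J a b c d := by
  refine ⟨A 0 0, A 0 1, A 1 0, A 1 1, ?_, fun x hx => ?_⟩
  · have := A.det_ne_zero
    rwa [Matrix.det_fin_two] at this
  · have h1 := h x hx
    rw [OnePoint.smul_some_eq_ite] at h1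
    split_ifs at h1 with h2
    · exact absurd h1 (OnePoint.coe_ne_infty _)
    · rw [OnePoint.coe_eq_coe] at h1
      exact ⟨h2, by rw [h1, div_mul_cancel₀ _ h2]⟩

/-- Fixed points are roots of a polynomial of degree at most two, which vanishes identically only if
the map is the identity on `J`. -/
theorem IsProjectiveOn.finite_or_subset_fixedPoints {f : ℝ → ℝ} {J : Set ℝ} {a b c d : ℝ}
    (h : IsProjectiveOn f J a b c d) : ({x | f x = x} ∩ J).Finite ∨ J ⊆ {x | f x = x} := by
  set p : Polynomial ℝ := Polynomial.C c * Polynomial.X ^ 2 + Polynomial.C (d - a) * Polynomial.X -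
    Polynomial.C b with hp
  have heval : ∀ x, p.eval x = c * x ^ 2 + (d - a) * x - b := fun x => by simp [hp]
  by_cases h0 : p = 0
  · refine Or.inr fun x hx => ?_
    obtain ⟨h1, h2⟩ := h.2 x hx
    have h3 := heval x
    rw [h0, Polynomial.eval_zero] at h3
    apply mul_right_cancel₀ h1
    linarith
  · refine Or.inl ((Polynomial.finite_setOfPred_isRoot h0).subset ?_)
    rintro x ⟨hx, hxJ⟩
    obtain ⟨h1, h2⟩ := h.2 x hxJ
    rw [show f x = x from hx] at h2
    change p.eval x = 0
    rw [heval]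
    linarith

/-- Near a fixed point `x`, a fractional linear map is affine in the coordinate `1 / (z - x)`. -/
theorem IsProjectiveOn.isAffineGerm {f : ℝ → ℝ} {J : Set ℝ} {a b c d : ℝ}
    (h : IsProjectiveOn f J a b c d) {x : ℝ} {l : Filter ℝ} [l.NeBot] (hl : l ≤ 𝓝[≠] x)
    (hJ : J ∈ l) (hf : ContinuousAt f x) (hx : f x = x) :
    IsAffineGerm l (fun z => (z - x)⁻¹) f := by
  have hl' : l ≤ 𝓝 x := hl.trans nhdsWithin_le_nhds
  -- The point `x` may be a breakpoint outside `J`, so the equation there comes from a limit.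
  have hlim : x * (c * x + d) = a * x + b := by
    have h1 : Tendsto (fun z => f z * (c * z + d)) l (𝓝 (x * (c * x + d))) := by
      have : ContinuousAt (fun z => f z * (c * z + d)) x := by fun_prop
      have h2 := this.tendsto.mono_left hl'
      rwa [hx] at h2
    have h2 : Tendsto (fun z => a * z + b) l (𝓝 (a * x + b)) := by
      have : ContinuousAt (fun z => a * z + b) x := by fun_prop
      exact this.tendsto.mono_left hl'
    exact tendsto_nhds_unique h1 (h2.congr' (mem_of_superset hJ fun z hz => (h.2 z hz).2.symm))
  have hacx : a - c * x ≠ 0 := by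
    intro h0
    apply h.1
    have h1 : a = c * x := by linarith
    have h2 : b = d * x := by
      rw [h1] at hlim
      linarith
    rw [h1, h2]
    ring
  refine ⟨(c * x + d) / (a - c * x), c / (a - c * x), ?_⟩
  filter_upwards [hJ, hl self_mem_nhdsWithin] with z hzJ hzx
  obtain ⟨h1, h2⟩ := h.2 z hzJ
  have hzx' : z - x ≠ 0 := sub_ne_zero.mpr hzx
  have key : (f z - x) * (c * z + d) = (a - c * x) * (z - x) := by linarith
  have hfz : f z - x ≠ 0 := by
    intro h0
    rw [h0, zero_mul] at key
    exact mul_ne_zero hacx hzx' key.symm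
  have hrhs : (c * x + d) / (a - c * x) * (z - x)⁻¹ + c / (a - c * x) =
      (c * z + d) / ((a - c * x) * (z - x)) := by
    field_simp
    ring
  rw [hrhs, ← key]
  field_simp

/-- A fractional linear map that preserves an end at infinity is affine there. -/
theorem IsProjectiveOn.isAffineGerm_of_cobounded {f : ℝ → ℝ} {J : Set ℝ} {a b c d : ℝ}
    (h : IsProjectiveOn f J a b c d) {l : Filter ℝ} [l.NeBot] (hJ : J ∈ l)
    (hl : l ≤ Bornology.cobounded ℝ) (hf : Tendsto f l (Bornology.cobounded ℝ)) :
    IsAffineGerm l id f := by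
  have hz0 : Tendsto (fun z : ℝ => z⁻¹) l (𝓝 0) := tendsto_inv₀_cobounded.mono_left hl
  have hf0 : Tendsto (fun z : ℝ => (f z)⁻¹) l (𝓝 0) := tendsto_inv₀_cobounded.comp hf
  have hne : ∀ᶠ z in l, z ≠ 0 := hl (Bornology.eventually_ne_cobounded 0)
  have hfne : ∀ᶠ z in l, f z ≠ 0 := hf.eventually (Bornology.eventually_ne_cobounded 0)
  -- Dividing the equation by `z * f z` and passing to the limit leaves only `c`.
  have hc : c = 0 := by
    have h1 : Tendsto (fun z : ℝ => c + d * z⁻¹) l (𝓝 (c + d * 0)) :=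
      tendsto_const_nhds.add (hz0.const_mul d)
    have h2 : Tendsto (fun z : ℝ => (a + b * z⁻¹) * (f z)⁻¹) l (𝓝 ((a + b * 0) * 0)) :=
      (tendsto_const_nhds.add (hz0.const_mul b)).mul hf0
    have h3 := tendsto_nhds_unique h1 (h2.congr' ?_)
    · simpa using h3
    · filter_upwards [hJ, hne, hfne] with z hzJ hz hfz
      have := (h.2 z hzJ).2
      field_simp
      linarith
  have hd : d ≠ 0 := by
    rintro rfl
    exact h.1 (by rw [hc]; ring)
  refine ⟨a / d, b / d, mem_of_superset hJ fun z hz => ?_⟩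
  have := (h.2 z hz).2
  rw [hc, zero_mul, zero_add] at this
  simp only [Set.mem_ofPred_eq, id]
  field_simp
  exact this

/-- The extension of an order automorphism of `ℝ` to the extended reals. -/
def erealExtend : (ℝ ≃o ℝ) →* (EReal ≃o EReal) where
  toFun f := (f.withTopCongr).withBotCongr
  map_one' := by
    ext x
    induction x using EReal.rec <;> rfl
  map_mul' f g := by
    ext x
    induction x using EReal.rec <;> rfl

theorem erealExtend_coe (f : ℝ ≃o ℝ) (x : ℝ) : erealExtend f x = (f x : ℝ) :=
  rfl

theorem erealExtend_injective : Function.Injective erealExtend := by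
  intro f g h
  ext x
  have := congrArg (fun e : EReal ≃o EReal => e x) h
  simpa [erealExtend_coe] using this

theorem EReal.nhdsGT_coe (x : ℝ) : 𝓝[>] (x : EReal) = (𝓝[>] x).map Real.toEReal := by
  rw [EReal.isOpenEmbedding_coe.isInducing.map_nhdsWithin_eq, EReal.image_coe_Ioi,
    nhdsWithin_Ioo_eq_nhdsGT (EReal.coe_lt_top x)]

theorem EReal.nhdsLT_coe (x : ℝ) : 𝓝[<] (x : EReal) = (𝓝[<] x).map Real.toEReal := by
  rw [EReal.isOpenEmbedding_coe.isInducing.map_nhdsWithin_eq, EReal.image_coe_Iio,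
    nhdsWithin_Ioo_eq_nhdsLT (EReal.bot_lt_coe x)]

theorem EReal.nhdsGT_bot : 𝓝[>] (⊥ : EReal) = atBot.map Real.toEReal := by
  rw [← EReal.nhdsWithin_bot, ← Set.compl_Iic, Set.Iic_bot]

theorem EReal.nhdsLT_top : 𝓝[<] (⊤ : EReal) = atTop.map Real.toEReal := by
  rw [← EReal.nhdsWithin_top, ← Set.compl_Ici, Set.Ici_top]

theorem IsAffineGerm.erealExtend {l : Filter ℝ} {u : ℝ → ℝ} {f : ℝ ≃o ℝ}
    (h : IsAffineGerm l u f) :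
    IsAffineGerm (l.map Real.toEReal) (u ∘ EReal.toReal) (erealExtend f) := by
  obtain ⟨α, β, h⟩ := h
  refine ⟨α, β, ?_⟩
  rw [eventually_map]
  filter_upwards [h] with z hz
  simpa [erealExtend_coe] using hz

theorem exists_injOn_map_coe {l : Filter ℝ} {u : ℝ → ℝ} (hu : Function.Injective u) :
    ∃ s ∈ l.map Real.toEReal, Set.InjOn (u ∘ EReal.toReal) s := by
  refine ⟨Set.range Real.toEReal, range_mem_map, ?_⟩
  rintro _ ⟨y, rfl⟩ _ ⟨z, rfl⟩ h
  exact congrArg _ (hu (by simpa using h))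

/-- The coordinate is `(z - x)⁻¹` at a real point `x` and `z` itself at the two infinite ends, where
a projective map preserving the end is affine. -/
theorem hasAffineGerms_of_isPiecewiseProjective :
    HasAffineGerms (erealExtend ''
      {f : ℝ ≃o ℝ | ∃ h : ℝ ≃ₜ ℝ, IsPiecewiseProjective h ∧ ⇑h = ⇑f}) where
  finite_frontier := by
    rintro _ ⟨f, ⟨h, ⟨S, hS⟩, hf⟩, rfl⟩
    have h1 : (frontier {x : ℝ | f x = x}).Finite := by
      refine finite_frontier_of_forall_ordConnected (isClosed_eq f.continuous continuous_id) S
        fun J _ hJ hJS => ?_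
      obtain ⟨A, hA⟩ := hS J hJ hJS
      rw [hf] at hA
      obtain ⟨a, b, c, d, hproj⟩ := exists_isProjectiveOn hA
      exact hproj.finite_or_subset_fixedPoints
    have hpre : Real.toEReal ⁻¹' {x | erealExtend f x = x} = {x : ℝ | f x = x} := by
      ext x
      simp [erealExtend_coe]
    rw [← hpre, ← EReal.isOpenEmbedding_coe.isOpenMap.preimage_frontier_eq_frontier_preimage
      EReal.isOpenEmbedding_coe.continuous] at h1
    refine ((h1.image Real.toEReal).union (Set.toFinite {⊥, ⊤})).subset fun x hx => ?_
    induction x with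
    | bot => simp
    | coe x => exact Or.inl ⟨x, hx, rfl⟩
    | top => simp
  right := by
    intro x hx
    induction x with
    | top => exact absurd rfl hx
    | bot =>
      rw [EReal.nhdsGT_bot]
      refine ⟨_, exists_injOn_map_coe (u := id) Function.injective_id, ?_⟩
      rintro _ ⟨f, ⟨h, ⟨S, hS⟩, hf⟩, rfl⟩ -
      obtain ⟨M, hM⟩ := S.finite_toSet.bddBelow
      obtain ⟨A, hA⟩ := hS (Set.Iio M) Set.ordConnected_Iio
        (Set.disjoint_left.mpr fun z hz hzS => (hM hzS).not_gt hz)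
      rw [hf] at hA
      obtain ⟨a, b, c, d, hproj⟩ := exists_isProjectiveOn hA
      refine (hproj.isAffineGerm_of_cobounded (Iio_mem_atBot M) ?_ ?_).erealExtend
      · exact IsOrderBornology.atBot_le_cobounded
      · exact f.tendsto_atBot.mono_right IsOrderBornology.atBot_le_cobounded
    | coe x =>
      rw [EReal.nhdsGT_coe]
      refine ⟨_, exists_injOn_map_coe (u := fun z => (z - x)⁻¹) ?_, ?_⟩
      -- Injectivity holds on all of `ℝ` thanks to the convention `0⁻¹ = 0`.
      · exact inv_injective.comp (sub_left_injective (b := x))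
      rintro _ ⟨f, ⟨h, ⟨S, hS⟩, hf⟩, rfl⟩ hfix
      obtain ⟨y, hy, hdisj⟩ := exists_disjoint_Ioo_right S (lt_add_one x)
      obtain ⟨A, hA⟩ := hS _ Set.ordConnected_Ioo hdisj
      rw [hf] at hA
      obtain ⟨a, b, c, d, hproj⟩ := exists_isProjectiveOn hA
      rw [erealExtend_coe, EReal.coe_eq_coe_iff] at hfix
      exact (hproj.isAffineGerm (l := 𝓝[>] x) (nhdsWithin_mono _ fun z hz => ne_of_gt hz)
        (Ioo_mem_nhdsGT hy) f.continuous.continuousAt hfix).erealExtend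
  left := by
    intro x hx
    induction x with
    | bot => exact absurd rfl hx
    | top =>
      rw [EReal.nhdsLT_top]
      refine ⟨_, exists_injOn_map_coe (u := id) Function.injective_id, ?_⟩
      rintro _ ⟨f, ⟨h, ⟨S, hS⟩, hf⟩, rfl⟩ -
      obtain ⟨M, hM⟩ := S.finite_toSet.bddAbove
      obtain ⟨A, hA⟩ := hS (Set.Ioi M) Set.ordConnected_Ioi
        (Set.disjoint_left.mpr fun z hz hzS => (hM hzS).not_gt hz)
      rw [hf] at hA
      obtain ⟨a, b, c, d, hproj⟩ := exists_isProjectiveOn hA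
      refine (hproj.isAffineGerm_of_cobounded (Ioi_mem_atTop M) ?_ ?_).erealExtend
      · exact IsOrderBornology.atTop_le_cobounded
      · exact f.tendsto_atTop.mono_right IsOrderBornology.atTop_le_cobounded
    | coe x =>
      rw [EReal.nhdsLT_coe]
      refine ⟨_, exists_injOn_map_coe (u := fun z => (z - x)⁻¹) ?_, ?_⟩
      · exact inv_injective.comp (sub_left_injective (b := x))
      rintro _ ⟨f, ⟨h, ⟨S, hS⟩, hf⟩, rfl⟩ hfix
      obtain ⟨y, hy, hdisj⟩ := exists_disjoint_Ioo_left S (sub_one_lt x)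
      obtain ⟨A, hA⟩ := hS _ Set.ordConnected_Ioo hdisj
      rw [hf] at hA
      obtain ⟨a, b, c, d, hproj⟩ := exists_isProjectiveOn hA
      rw [erealExtend_coe, EReal.coe_eq_coe_iff] at hfix
      exact (hproj.isAffineGerm (l := 𝓝[<] x) (nhdsWithin_mono _ fun z hz => ne_of_lt hz)
        (Ioo_mem_nhdsLT hy) f.continuous.continuousAt hfix).erealExtend

end PiecewiseProjective

/-! ### Reduction to orientation-preserving maps. -/

section Orientation

open scoped commutatorElement

theorem Homeomorph.apply_inv_apply {X : Type*} [TopologicalSpace X] (f : X ≃ₜ X) (x : X) :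
    f (f⁻¹ x) = x :=
  f.apply_symm_apply x

variable {X : Type*} [LinearOrder X] [TopologicalSpace X]

theorem Homeomorph.strictMono_inv {f : X ≃ₜ X} (hf : StrictMono f) : StrictMono ⇑(f⁻¹) := by
  intro x y hxy
  rw [← hf.lt_iff_lt, f.apply_inv_apply, f.apply_inv_apply]
  exact hxy

theorem Homeomorph.strictAnti_inv {f : X ≃ₜ X} (hf : StrictAnti f) : StrictAnti ⇑(f⁻¹) := by
  intro x y hxy
  rw [← hf.lt_iff_gt, f.apply_inv_apply, f.apply_inv_apply]
  exact hxy

variable (X) in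
/-- The orientation-preserving homeomorphisms of a linear order. -/
def orientationPreserving : Subgroup (X ≃ₜ X) where
  carrier := {f | StrictMono f}
  one_mem' := strictMono_id
  mul_mem' hf hg := hf.comp hg
  inv_mem' := Homeomorph.strictMono_inv

/-- Orientation-preserving homeomorphisms as order automorphisms. -/
def orientationPreservingToOrderIso : orientationPreserving X →* (X ≃o X) where
  toFun f := { f.1.toEquiv with map_rel_iff' := f.2.le_iff_le }
  map_one' := rfl
  map_mul' _ _ := rfl

theorem orientationPreservingToOrderIso_injective :
    Function.Injective (orientationPreservingToOrderIso (X := X)) := by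
  intro f g h
  refine Subtype.ext (Homeomorph.ext fun x => ?_)
  exact congrArg (fun e : X ≃o X => e x) h

/-- A map and its inverse have the same orientation character, so a commutator contains an even
number of reversals. -/
theorem commutatorElement_mem_orientationPreserving
    (h : ∀ f : X ≃ₜ X, StrictMono f ∨ StrictAnti f) (f g : X ≃ₜ X) :
    ⁅f, g⁆ ∈ orientationPreserving X := by
  change StrictMono (f ∘ g ∘ ⇑(f⁻¹) ∘ ⇑(g⁻¹))
  rcases h f with hf | hf <;> rcases h g with hg | hg
  · exact hf.comp (hg.comp ((Homeomorph.strictMono_inv hf).comp (Homeomorph.strictMono_inv hg)))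
  · exact hf.comp (hg.comp ((Homeomorph.strictMono_inv hf).comp_strictAnti
      (Homeomorph.strictAnti_inv hg)))
  · exact hf.comp (hg.comp_strictAnti ((Homeomorph.strictAnti_inv hf).comp_strictMono
      (Homeomorph.strictMono_inv hg)))
  · exact hf.comp (hg.comp_strictMono ((Homeomorph.strictAnti_inv hf).comp
      (Homeomorph.strictAnti_inv hg)))

end Orientation

/-! ### Assembly of the two cases. -/

/-- A group of homeomorphisms of a linear order `X` has vanishing second bounded cohomology if its
orientation-preserving elements extend to a complete linear order with affine germs. -/
theorem subsingleton_boundedCohomology_two_of_extension {X : Type} [LinearOrder X]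
    [TopologicalSpace X] (hX : ∀ f : X ≃ₜ X, StrictMono f ∨ StrictAnti f) {Y : Type*}
    [CompleteLinearOrder Y] [DenselyOrdered Y] [TopologicalSpace Y] [OrderTopology Y]
    {ι : (X ≃o X) →* (Y ≃o Y)} (hι : Function.Injective ι) {G : Subgroup (X ≃ₜ X)}
    {A : Set (X ≃o X)} (hA : HasAffineGerms (ι '' A))
    (hG : ∀ g ∈ G, ∀ f : X ≃o X, ⇑g = ⇑f → f ∈ A) : Subsingleton (BoundedCohomology G 2) := by
  let ρ : (orientationPreserving X).subgroupOf G →* (Y ≃o Y) :=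
    (ι.comp orientationPreservingToOrderIso).comp
      (G.subtype.subgroupComap (orientationPreserving X))
  have hsub : Set.range ρ ⊆ ι '' A := by
    rintro _ ⟨g, rfl⟩
    exact ⟨_, hG g.1.1 g.1.2 _ rfl, rfl⟩
  refine subsingleton_boundedCohomology_two_of_hasAffineGerms
    (P := (orientationPreserving X).subgroupOf G) (ρ := ρ) (fun g h => ?_) ?_
    (hA.mono hsub)
  · exact commutatorElement_mem_orientationPreserving hX g.1 h.1
  · intro g h hgh
    have := orientationPreservingToOrderIso_injective (hι hgh)
    exact Subtype.ext (Subtype.ext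
      (congrArg (fun k : orientationPreserving X => (k : X ≃ₜ X)) this))

theorem theorem1p3 :
    (∀ G : Subgroup (I ≃ₜ I), (∀ g ∈ G, IsPiecewiseLinear g) →
      Subsingleton (BoundedCohomology G 2)) ∧
    (∀ G : Subgroup (ℝ ≃ₜ ℝ), (∀ g ∈ G, IsPiecewiseProjective g) →
      Subsingleton (BoundedCohomology G 2)) := by
  refine ⟨fun G hG => ?_, fun G hG => ?_⟩
  · exact subsingleton_boundedCohomology_two_of_extension
      (fun f => f.continuous.strictMono_of_inj f.injective) (ι := MonoidHom.id _)
      Function.injective_id (A := {f : I ≃o I | ∃ h : I ≃ₜ I, IsPiecewiseLinear h ∧ ⇑h = ⇑f})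
      (hasAffineGerms_of_isPiecewiseLinear.mono (by rintro _ ⟨f, hf, rfl⟩; exact hf))
      fun g hg f hf => ⟨g, hG g hg, hf⟩
  · exact subsingleton_boundedCohomology_two_of_extension
      (fun f => f.continuous.strictMono_of_inj f.injective) erealExtend_injective
      hasAffineGerms_of_isPiecewiseProjective fun g hg f hf => ⟨g, hG g hg, hf⟩
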